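/- Rings are associative but need not be unital or commutative. Let $R$ be a ring and let $(P,Q,\psi)$ be an $R$-system, i.e. $P$ and $Q$ are $R$-bimodules and $\psi\colon P\otimes_R Q\to R$ is an $R$-bimodule homomorphism. A covariant representation of $(P,Q,\psi)$ on a ring $B$ consists of additive maps $S\colon P\to B$, $T\colon Q\to B$ and a ring homomorphism $\sigma\colon R\to B$ with $S(pr)=S(p)\sigma(r)$, $S(rp)=\sigma(r)S(p)$, $T(qr)=T(q)\sigma(r)$, $T(rq)=\sigma(r)T(q)$ and $\sigma(\psi(p\otimes q))=S(p)T(q)$ for all $r\in R$, $p\in P$, $q\in Q$. The Toeplitz ring $\mathcal T=\mathcal T_{(P,Q,\psi)}$, with maps $\iota_P,\iota_Q,\iota_R$, is the ring of the universal covariant representation. For $n\in\mathbb Z$ let $\mathcal T_n$ be the additive subgroup generated by the products of elements of $\iota_R(R)$ (degree $0$), $\iota_Q(Q)$ (degree $1$) and $\iota_P(P)$ (degree $-1$) of total degree $n$. For $q\in Q$, $p\in P$ let $\theta_{q,p}\in\mathrm{End}(Q)$, $\theta_{q,p}(x)=q\,\psi(p\otimes x)$, and $\theta_{p,q}\in\mathrm{End}(P)$,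 $\theta_{p,q}(y)=\psi(y\otimes q)\,p$; let $\mathcal F_P(Q)$ and $\mathcal F_Q(P)$ be the additive spans of the $\theta_{q,p}$ and of the $\theta_{p,q}$, respectively. Condition (FS) says that for all finite sets $\{q_1,\dots,q_n\}\subseteq Q$ and $\{p_1,\dots,p_m\}\subseteq P$ there are $\Theta\in\mathcal F_P(Q)$ and $\Phi\in\mathcal F_Q(P)$ with $\Theta(q_i)=q_i$ and $\Phi(p_j)=p_j$ for all $i,j$. Let $\Delta\colon R\to\mathrm{End}(Q)$, $\Delta(r)(q)=rq$. A two-sided ideal $J$ of $R$ is $\psi$-compatible if $\Delta(J)\subseteq\mathcal F_P(Q)$. Under Condition (FS) there is a unique additive map $\pi\colon\mathcal F_P(Q)\to\mathcal T$ with $\pi(\theta_{q,p})=\iota_Q(q)\iota_P(p)$ for all $q\in Q$, $p\in P$, and for a $\psi$-compatible ideal $J$ the relative Cuntz--Pimsner ring $\mathcal O(J)=\mathcal O_{(P,Q,\psi)}(J)$ is the quotient of $\mathcal T$ by the two-sided ideal generated by $\{\iota_R(x)-\pi(\Delta(x)) : x\in J\}$; let $\mathcal O(J)_n$ be the image of $\mathcal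 T_n$. Proposition. The family $(\mathcal T_n)_{n\in\mathbb Z}$ is a $\mathbb Z$-grading of $\mathcal T_{(P,Q,\psi)}$, and every central idempotent of $\mathcal T_{(P,Q,\psi)}$ lies in $\mathcal T_0$. If, moreover, $(P,Q,\psi)$ satisfies Condition (FS) and $J$ is a $\psi$-compatible ideal of $R$, then $(\mathcal O(J)_n)_{n\in\mathbb Z}$ is a $\mathbb Z$-grading of $\mathcal O_{(P,Q,\psi)}(J)$, and every central idempotent of $\mathcal O_{(P,Q,\psi)}(J)$ lies in $\mathcal O(J)_0$. -/

import Mathlib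

open scoped TensorProduct

namespace CuntzPimsner

/-- A bimodule `M` over a possibly non-unital ring `R`: a left action `r ↦ (m ↦ r • m)` and a right
action `r ↦ (m ↦ m • r)` by additive endomorphisms, that is, a ring homomorphism
`R → End(M)` and a ring homomorphism `Rᵐᵒᵖ → End(M)`, which commute with one another. -/
class Bimodule (R : Type*) (M : Type*) [NonUnitalRing R] [AddCommGroup M] where
  left : R →ₙ+* AddMonoid.End M
  right : Rᵐᵒᵖ →ₙ+* AddMonoid.End M
  comm : ∀ (r : R) (s : Rᵐᵒᵖ) (m : M), left r (right s m) = right s (left r m)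

/-- The left action `r • m`. -/
def lact {R M : Type*} [NonUnitalRing R] [AddCommGroup M] [Bimodule R M] (r : R) (m : M) : M :=
  Bimodule.left r m

/-- The right action `m • r`. -/
def ract {R M : Type*} [NonUnitalRing R] [AddCommGroup M] [Bimodule R M] (m : M) (r : R) : M :=
  Bimodule.right (MulOpposite.op r) m

section Actions

variable {R M : Type*} [NonUnitalRing R] [AddCommGroup M] [Bimodule R M]

theorem lact_add (r : R) (m n : M) : lact r (m + n) = lact r m + lact r n := map_add _ m n

theorem add_lact (r s : R) (m : M) : lact (r + s) m = lact r m + lact s m := by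
  rw [lact, map_add]; rfl

theorem mul_lact (r s : R) (m : M) : lact (r * s) m = lact r (lact s m) := by
  simp [lact, map_mul]

theorem add_ract (m n : M) (r : R) : ract (m + n) r = ract m r + ract n r := map_add _ m n

theorem ract_add (m : M) (r s : R) : ract m (r + s) = ract m r + ract m s := by
  rw [ract, MulOpposite.op_add, map_add]; rfl

theorem ract_mul (m : M) (r s : R) : ract m (r * s) = ract (ract m r) s := by
  simp [ract, map_mul]

theorem lact_ract (r : R) (m : M) (s : R) : lact r (ract m s) = ract (lact r m) s :=
  Bimodule.comm r (MulOpposite.op s) m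

end Actions

section Tensor

variable (R P Q : Type*) [NonUnitalRing R] [AddCommGroup P] [AddCommGroup Q]
  [Bimodule R P] [Bimodule R Q]

/-- The subgroup of `P ⊗_ℤ Q` generated by all `(p • r) ⊗ q - p ⊗ (r • q)`. -/
def balancing : AddSubgroup (P ⊗[ℤ] Q) :=
  AddSubgroup.closure {t | ∃ (p : P) (r : R) (q : Q), t = ract p r ⊗ₜ[ℤ] q - p ⊗ₜ[ℤ] lact r q}

/-- The tensor product `P ⊗_R Q` over the possibly non-unital ring `R`. -/
abbrev BalTensor : Type _ := (P ⊗[ℤ] Q) ⧸ balancing R P Q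

variable {P Q}

/-- The pure tensor `p ⊗ q` in `P ⊗_R Q`. -/
def tens (p : P) (q : Q) : BalTensor R P Q := QuotientAddGroup.mk (p ⊗ₜ[ℤ] q)

theorem add_tens (p p' : P) (q : Q) : tens R (p + p') q = tens R p q + tens R p' q := by
  simp [tens, TensorProduct.add_tmul]

theorem tens_add (p : P) (q q' : Q) : tens R p (q + q') = tens R p q + tens R p q' := by
  simp [tens, TensorProduct.tmul_add]

theorem ract_tens (p : P) (r : R) (q : Q) : tens R (ract p r) q = tens R p (lact r q) := by
  rw [tens, tens, ← sub_eq_zero, ← QuotientAddGroup.mk_sub, QuotientAddGroup.eq_zero_iff]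
  exact AddSubgroup.subset_closure ⟨p, r, q, rfl⟩

end Tensor

/-- An `R`-system `(P, Q, ψ)` on two `R`-bimodules `P` and `Q`: an `R`-bimodule homomorphism
`ψ : P ⊗_R Q → R`, i.e. an additive map on `P ⊗_R Q` that respects the left action
`r • (p ⊗ q) = (r • p) ⊗ q` and the right action `(p ⊗ q) • r = p ⊗ (q • r)` (stated on the pure
tensors, which generate `P ⊗_R Q` additively). -/
structure RSystem (R P Q : Type*) [NonUnitalRing R] [AddCommGroup P] [AddCommGroup Q]
    [Bimodule R P] [Bimodule R Q] where
  ψ : BalTensor R P Q →+ R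
  map_left : ∀ (r : R) (p : P) (q : Q), ψ (tens R (lact r p) q) = r * ψ (tens R p q)
  map_right : ∀ (p : P) (q : Q) (r : R), ψ (tens R p (ract q r)) = ψ (tens R p q) * r

/-- The letters of the free ring from which the Toeplitz ring is built. -/
inductive Gen (R P Q : Type*)
  | coef (r : R)
  | left (p : P)
  | right (q : Q)

/-- A family `𝒜` of additive subgroups is a `ℤ`-grading of the possibly non-unital ring `A`. -/
def IsIntGrading {A : Type*} [NonUnitalRing A] (𝒜 : ℤ → AddSubgroup A) : Prop :=
  DirectSum.IsInternal 𝒜 ∧ ∀ (m n : ℤ) (a b : A), a ∈ 𝒜 m → b ∈ 𝒜 n → a * b ∈ 𝒜 (m + n)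

/-- The quotient of a possibly non-unital ring by a congruence, as a ring homomorphism. -/
def quotHom {A : Type*} [NonUnitalRing A] (c : RingCon A) : A →ₙ+* c.Quotient where
  toFun a := (a : c.Quotient)
  map_mul' _ _ := rfl
  map_zero' := rfl
  map_add' _ _ := rfl

namespace RSystem

variable {R P Q : Type*} [NonUnitalRing R] [AddCommGroup P] [AddCommGroup Q]
  [Bimodule R P] [Bimodule R Q] (X : RSystem R P Q)

/-- `ψ(p ⊗ q)`. -/
def pair (p : P) (q : Q) : R := X.ψ (tens R p q)

/-- A covariant representation `(S, T, σ, B)` of `(P, Q, ψ)` on a possibly non-unital ring `B`. -/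
structure CovRep (B : Type*) [NonUnitalRing B] where
  S : P →+ B
  T : Q →+ B
  σ : R →ₙ+* B
  S_ract : ∀ p r, S (ract p r) = S p * σ r
  S_lact : ∀ r p, S (lact r p) = σ r * S p
  T_ract : ∀ q r, T (ract q r) = T q * σ r
  T_lact : ∀ r q, T (lact r q) = σ r * T q
  σ_pair : ∀ p q, σ (X.pair p q) = S p * T q

/-! ### The Toeplitz ring -/

/-- The free (non-unital, associative) ring on the letters `r ∈ R`, `p ∈ P`, `q ∈ Q`. -/
abbrev FreeRing (R P Q : Type*) : Type _ := MonoidAlgebra ℤ (FreeSemigroup (Gen R P Q))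

/-- A word, as an element of the free ring. -/
noncomputable def word (w : FreeSemigroup (Gen R P Q)) : FreeRing R P Q := MonoidAlgebra.single w 1

/-- A letter, as an element of the free ring. -/
noncomputable def letter (x : Gen R P Q) : FreeRing R P Q := word (FreeSemigroup.of x)

/-- The defining relations of the Toeplitz ring: those of a covariant representation. -/
inductive ToeplitzRel : FreeRing R P Q → FreeRing R P Q → Prop
  | coef_add (r s : R) : ToeplitzRel (letter (.coef (r + s))) (letter (.coef r) + letter (.coef s))
  | coef_mul (r s : R) : ToeplitzRel (letter (.coef (r * s))) (letter (.coef r) * letter (.coef s))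
  | left_add (p p' : P) :
      ToeplitzRel (letter (.left (p + p'))) (letter (.left p) + letter (.left p'))
  | right_add (q q' : Q) :
      ToeplitzRel (letter (.right (q + q'))) (letter (.right q) + letter (.right q'))
  | left_ract (p : P) (r : R) :
      ToeplitzRel (letter (.left (ract p r))) (letter (.left p) * letter (.coef r))
  | left_lact (r : R) (p : P) :
      ToeplitzRel (letter (.left (lact r p))) (letter (.coef r) * letter (.left p))
  | right_ract (q : Q) (r : R) :
      ToeplitzRel (letter (.right (ract q r))) (letter (.right q) * letter (.coef r))
  | right_lact (r : R) (q : Q) :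
      ToeplitzRel (letter (.right (lact r q))) (letter (.coef r) * letter (.right q))
  | pair (p : P) (q : Q) :
      ToeplitzRel (letter (.coef (X.pair p q))) (letter (.left p) * letter (.right q))

/-- The Toeplitz ring `𝒯_(P,Q,ψ)`: the ring of the universal covariant representation of
`(P, Q, ψ)`, see `toeplitz_universal`. -/
def Toeplitz : Type _ := (ringConGen X.ToeplitzRel).Quotient

noncomputable instance : NonUnitalRing X.Toeplitz :=
  inferInstanceAs (NonUnitalRing (ringConGen X.ToeplitzRel).Quotient)

/-- The quotient map from the free ring onto the Toeplitz ring. -/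
noncomputable def toToeplitz : FreeRing R P Q →ₙ+* X.Toeplitz :=
  quotHom (ringConGen X.ToeplitzRel)

theorem toToeplitz_rel {a b : FreeRing R P Q} (h : X.ToeplitzRel a b) :
    X.toToeplitz a = X.toToeplitz b :=
  (RingCon.eq _).2 (RingConGen.Rel.of _ _ h)

/-- The universal covariant representation `(ι_P, ι_Q, ι_R)` on the Toeplitz ring. -/
noncomputable def univ : X.CovRep X.Toeplitz where
  S := AddMonoidHom.mk' (fun p ↦ X.toToeplitz (letter (.left p))) fun p p' ↦ by
    rw [X.toToeplitz_rel (.left_add p p'), map_add]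
  T := AddMonoidHom.mk' (fun q ↦ X.toToeplitz (letter (.right q))) fun q q' ↦ by
    rw [X.toToeplitz_rel (.right_add q q'), map_add]
  σ :=
    { AddMonoidHom.mk' (fun r ↦ X.toToeplitz (letter (.coef r))) fun r s ↦ by
        rw [X.toToeplitz_rel (.coef_add r s), map_add] with
      map_mul' := fun r s ↦ (X.toToeplitz_rel (.coef_mul r s)).trans (map_mul _ _ _) }
  S_ract p r := (X.toToeplitz_rel (.left_ract p r)).trans (map_mul _ _ _)
  S_lact r p := (X.toToeplitz_rel (.left_lact r p)).trans (map_mul _ _ _)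
  T_ract q r := (X.toToeplitz_rel (.right_ract q r)).trans (map_mul _ _ _)
  T_lact r q := (X.toToeplitz_rel (.right_lact r q)).trans (map_mul _ _ _)
  σ_pair p q := (X.toToeplitz_rel (.pair p q)).trans (map_mul _ _ _)

/-- Every covariant representation factors uniquely through the Toeplitz ring. -/
theorem toeplitz_universal {B : Type*} [NonUnitalRing B] (c : X.CovRep B) :
    ∃! φ : X.Toeplitz →ₙ+* B, (∀ p, φ (X.univ.S p) = c.S p) ∧ (∀ q, φ (X.univ.T q) = c.T q) ∧
      ∀ r, φ (X.univ.σ r) = c.σ r := by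
  let g : Gen R P Q → B := fun x ↦ match x with
    | .coef r => c.σ r
    | .left p => c.S p
    | .right q => c.T q
  let F : FreeRing R P Q →ₙₐ[ℤ] B := MonoidAlgebra.liftMagma ℤ (FreeSemigroup.lift g)
  have hF : ∀ x, F (letter x) = g x := fun x ↦ by
    simp [F, letter, word, MonoidAlgebra.liftMagma]
  have hle : ringConGen X.ToeplitzRel ≤ (TwoSidedIdeal.ker F).ringCon := by
    refine RingCon.ringConGen_le.2 fun a b h ↦ ?_
    rw [TwoSidedIdeal.ker_ringCon]
    cases h <;> simp only [map_add, map_mul, hF, g, c.S_ract, c.S_lact, c.T_ract, c.T_lact,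
      c.σ_pair]
  have hex : ∃ φ : X.Toeplitz →ₙ+* B, ∀ a, φ (X.toToeplitz a) = F a := by
    refine ⟨{ toFun := fun t ↦ Quotient.liftOn' t F fun a b h ↦ hle h
              map_zero' := map_zero F
              map_add' := ?_
              map_mul' := ?_ }, fun a ↦ rfl⟩
    · rintro ⟨a⟩ ⟨b⟩
      exact map_mul F a b
    · rintro ⟨a⟩ ⟨b⟩
      exact map_add F a b
  obtain ⟨φ, hφ⟩ := hex
  refine ⟨φ, ⟨fun p ↦ (hφ _).trans (hF _), fun q ↦ (hφ _).trans (hF _),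
    fun r ↦ (hφ _).trans (hF _)⟩, fun χ ⟨h1, h2, h3⟩ ↦ ?_⟩
  have key : ∀ a, χ (X.toToeplitz a) = φ (X.toToeplitz a) := by
    intro a
    have hw : ∀ w : FreeSemigroup (Gen R P Q),
        χ (X.toToeplitz (word w)) = φ (X.toToeplitz (word w)) := by
      intro w
      induction w using FreeSemigroup.recOnMul with
      | ih1 x =>
        rw [hφ]
        refine Eq.trans ?_ (hF x).symm
        cases x with
        | coef r => exact h3 r
        | left p => exact h1 p
        | right q => exact h2 q
      | ih2 x y hx hy =>
        have : (word (FreeSemigroup.of x * y) : FreeRing R P Q) =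
            word (FreeSemigroup.of x) * word y := by
          simp [word, MonoidAlgebra.single_mul_single]
        rw [this, map_mul, map_mul, map_mul, hx, hy]
    induction a using MonoidAlgebra.induction_linear with
    | zero => simp
    | add a b ha hb => simp only [map_add, ha, hb]
    | single w n =>
      have : (MonoidAlgebra.single w n : FreeRing R P Q) = n • word w := by
        simp [word]
      rw [this, map_zsmul, map_zsmul, map_zsmul, hw]
  ext ⟨a⟩
  exact key a

/-- The degree of a letter: `0` on `R`, `-1` on `P`, `1` on `Q`. -/
def letterDeg : Gen R P Q → ℤ
  | .coef _ => 0
  | .left _ => -1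
  | .right _ => 1

/-- The degree of a word: the sum of the degrees of its letters. -/
def wordDeg (w : FreeSemigroup (Gen R P Q)) : ℤ :=
  letterDeg w.head + (w.tail.map letterDeg).sum

/-- The component of degree `n` of the Toeplitz ring: the additive subgroup generated by the
products of elements `ι_R(r)`, `ι_P(p)`, `ι_Q(q)` of total degree `n`. -/
noncomputable def toeplitzDeg (n : ℤ) : AddSubgroup X.Toeplitz :=
  AddSubgroup.closure {t | ∃ w, wordDeg w = n ∧ t = X.toToeplitz (word w)}

/-! ### Condition (FS) and relative Cuntz-Pimsner rings -/

/-- The operator `θ_{q,p} : Q → Q`, `x ↦ q • ψ(p ⊗ x)`. -/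
def theta (q : Q) (p : P) : AddMonoid.End Q :=
  AddMonoidHom.mk' (fun x ↦ ract q (X.pair p x)) fun x y ↦ by
    rw [pair, tens_add, map_add, ract_add]; rfl

/-- The operator `θ_{p,q} : P → P`, `y ↦ ψ(y ⊗ q) • p`. -/
def theta' (p : P) (q : Q) : AddMonoid.End P :=
  AddMonoidHom.mk' (fun y ↦ lact (X.pair y q) p) fun x y ↦ by
    rw [pair, add_tens, map_add, add_lact]; rfl

/-- `ℱ_P(Q)`, the additive span of the operators `θ_{q,p}` on `Q`. -/
def finRank : AddSubgroup (AddMonoid.End Q) :=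
  AddSubgroup.closure {a | ∃ q p, a = X.theta q p}

/-- `ℱ_Q(P)`, the additive span of the operators `θ_{p,q}` on `P`. -/
def finRank' : AddSubgroup (AddMonoid.End P) :=
  AddSubgroup.closure {a | ∃ p q, a = X.theta' p q}

/-- Condition (FS). -/
def ConditionFS : Prop :=
  ∀ (s : Finset Q) (t : Finset P), ∃ Θ ∈ X.finRank, ∃ Φ ∈ X.finRank',
    (∀ q ∈ s, Θ q = q) ∧ ∀ p ∈ t, Φ p = p

/-- A two-sided ideal `J` of `R` is `ψ`-compatible if every `x ∈ J` acts on `Q` from the left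
as an element of `ℱ_P(Q)`, i.e. `J ⊆ Δ⁻¹(ℱ_P(Q))`. -/
def IsCompatible (J : TwoSidedIdeal R) : Prop :=
  ∀ x ∈ J, (Bimodule.left x : AddMonoid.End Q) ∈ X.finRank

/-- The graph of the additive map `π : ℱ_P(Q) → 𝒯_(P,Q,ψ)`, `θ_{q,p} ↦ ι_Q(q) ι_P(p)`: the
additive subgroup generated by the pairs `(θ_{q,p}, ι_Q(q) ι_P(p))`. Under Condition (FS) it is
the graph of a map with domain `ℱ_P(Q)`, see `existsUnique_piGraph`. -/
noncomputable def piGraph : AddSubgroup (AddMonoid.End Q × X.Toeplitz) :=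
  AddSubgroup.closure {a | ∃ q p, a = (X.theta q p, X.univ.T q * X.univ.S p)}

/-- Under Condition (FS), `piGraph` is the graph of a map on `ℱ_P(Q)`. -/
theorem existsUnique_piGraph (h : X.ConditionFS) {a : AddMonoid.End Q} (ha : a ∈ X.finRank) :
    ∃! t, (a, t) ∈ X.piGraph := by
  have hex : ∃ t, (a, t) ∈ X.piGraph := by
    induction ha using AddSubgroup.closure_induction with
    | mem b hb =>
      obtain ⟨q, p, rfl⟩ := hb
      exact ⟨_, AddSubgroup.subset_closure ⟨q, p, rfl⟩⟩
    | zero => exact ⟨0, X.piGraph.zero_mem⟩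
    | add b c _ _ hb hc =>
      obtain ⟨t, ht⟩ := hb
      obtain ⟨u, hu⟩ := hc
      exact ⟨t + u, X.piGraph.add_mem ht hu⟩
    | neg b _ hb =>
      obtain ⟨t, ht⟩ := hb
      exact ⟨-t, X.piGraph.neg_mem ht⟩
  have hmul : ∀ b ∈ X.piGraph, ∀ x, b.2 * X.univ.T x = X.univ.T (b.1 x) := by
    intro b hb x
    induction hb using AddSubgroup.closure_induction with
    | mem b hb =>
      obtain ⟨q, p, rfl⟩ := hb
      change X.univ.T q * X.univ.S p * X.univ.T x = X.univ.T (ract q (X.pair p x))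
      rw [X.univ.T_ract, X.univ.σ_pair, mul_assoc]
    | zero => exact (zero_mul _).trans (map_zero X.univ.T).symm
    | add b c _ _ hb hc =>
      refine (add_mul _ _ _).trans ?_
      rw [hb, hc]
      exact (map_add X.univ.T _ _).symm
    | neg b _ hb =>
      refine (neg_mul _ _).trans ?_
      rw [hb]
      exact (map_neg X.univ.T _).symm
  have hfix : ∀ b ∈ X.piGraph, ∃ s : Finset P, ∀ w,
      (∀ p ∈ s, X.univ.S p * w = X.univ.S p) → b.2 * w = b.2 := by
    classical
    intro b hb
    induction hb using AddSubgroup.closure_induction with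
    | mem b hb =>
      obtain ⟨q, p, rfl⟩ := hb
      exact ⟨{p}, fun w hw ↦ by rw [mul_assoc, hw p (by simp)]⟩
    | zero => exact ⟨∅, fun w _ ↦ zero_mul w⟩
    | add b c _ _ hb hc =>
      obtain ⟨s, hs⟩ := hb
      obtain ⟨u, hu⟩ := hc
      refine ⟨s ∪ u, fun w hw ↦ (add_mul _ _ _).trans ?_⟩
      rw [hs w fun p hp ↦ hw p (by simp [hp]), hu w fun p hp ↦ hw p (by simp [hp])]
      rfl
    | neg b _ hb =>
      obtain ⟨s, hs⟩ := hb
      refine ⟨s, fun w hw ↦ (neg_mul _ _).trans ?_⟩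
      rw [hs w hw]
      rfl
  have hS : ∀ Φ ∈ X.finRank', ∃ w, (∀ p, X.univ.S (Φ p) = X.univ.S p * w) ∧
      ∀ t, (∀ x, t * X.univ.T x = 0) → t * w = 0 := by
    intro Φ hΦ
    induction hΦ using AddSubgroup.closure_induction with
    | mem b hb =>
      obtain ⟨p, q, rfl⟩ := hb
      refine ⟨X.univ.T q * X.univ.S p, fun y ↦ ?_, fun t ht ↦ by rw [← mul_assoc, ht, zero_mul]⟩
      change X.univ.S (lact (X.pair y q) p) = _
      rw [X.univ.S_lact, X.univ.σ_pair, mul_assoc]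
    | zero => exact ⟨0, fun p ↦ (map_zero X.univ.S).trans (mul_zero _).symm, fun t _ ↦ mul_zero t⟩
    | add b c _ _ hb hc =>
      obtain ⟨w, hw, hw'⟩ := hb
      obtain ⟨v, hv, hv'⟩ := hc
      refine ⟨w + v, fun p ↦ ?_, fun t ht ↦ by rw [mul_add, hw' t ht, hv' t ht, add_zero]⟩
      rw [mul_add, ← hw, ← hv]
      exact map_add X.univ.S _ _
    | neg b _ hb =>
      obtain ⟨w, hw, hw'⟩ := hb
      refine ⟨-w, fun p ↦ ?_, fun t ht ↦ by rw [mul_neg, hw' t ht, neg_zero]⟩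
      rw [mul_neg, ← hw]
      exact map_neg X.univ.S _
  obtain ⟨t, ht⟩ := hex
  refine ⟨t, ht, fun u hu ↦ ?_⟩
  have hd : (a - a, u - t) ∈ X.piGraph := X.piGraph.sub_mem hu ht
  obtain ⟨s, hs⟩ := hfix _ hd
  obtain ⟨_, _, Φ, hΦ, _, hΦs⟩ := h ∅ s
  obtain ⟨w, hw, hw'⟩ := hS Φ hΦ
  rw [← sub_eq_zero, ← show (u - t) * w = u - t from hs w fun p hp ↦ by rw [← hw, hΦs p hp]]
  refine hw' _ fun x ↦ (hmul _ hd x).trans ?_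
  rw [sub_self]
  exact map_zero X.univ.T

/-- The two-sided ideal `𝒯(J)` generated by all `ι_R(x) - π(Δ(x))` with `x ∈ J`, where
`Δ(x) ∈ ℱ_P(Q)` is the left action of `x` on `Q`. -/
noncomputable def cpIdeal (J : TwoSidedIdeal R) : TwoSidedIdeal X.Toeplitz :=
  TwoSidedIdeal.span {a | ∃ x ∈ J, ∃ t : X.Toeplitz,
    ((Bimodule.left x : AddMonoid.End Q), t) ∈ X.piGraph ∧ a = X.univ.σ x - t}

/-- The relative Cuntz-Pimsner ring `𝒪_(P,Q,ψ)(J) = 𝒯_(P,Q,ψ) / 𝒯(J)`. -/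
def RelCP (J : TwoSidedIdeal R) : Type _ := (X.cpIdeal J).ringCon.Quotient

noncomputable instance (J : TwoSidedIdeal R) : NonUnitalRing (X.RelCP J) :=
  inferInstanceAs (NonUnitalRing (X.cpIdeal J).ringCon.Quotient)

/-- The quotient map `𝒯_(P,Q,ψ) → 𝒪_(P,Q,ψ)(J)`. -/
noncomputable def toRelCP (J : TwoSidedIdeal R) : X.Toeplitz →ₙ+* X.RelCP J :=
  quotHom (X.cpIdeal J).ringCon

/-- The component of degree `n` of `𝒪_(P,Q,ψ)(J)`: the image of that of the Toeplitz ring. -/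
noncomputable def relCPDeg (J : TwoSidedIdeal R) (n : ℤ) : AddSubgroup (X.RelCP J) :=
  (X.toeplitzDeg n).map (X.toRelCP J : X.Toeplitz →+ X.RelCP J)

end RSystem

end CuntzPimsner

/-! A `ℤ`-grading on `A` is encoded by a coaction: a ring homomorphism `δ` from `A` to Laurent
polynomials over the unitization of `A`, with `δ a = a tⁿ` for `a` of degree `n`. Its coefficients
read off homogeneous components, so the degree subgroups are independent as soon as `δ` exists.

If `f` is a central idempotent, then `δ f` is idempotent, and comparing coefficients in `a tᵐ · δ f
= δ f · a tᵐ` shows that its coefficients are central. Hence `δ f` lives in `K[t, t⁻¹]` with `K` the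
commutative centre of the unitization. Idempotents there are constant: modulo each prime of `K` the
Laurent polynomials form a domain, so an idempotent agrees with its value at `t = 1` up to a
nilpotent, and commuting idempotents that differ by a nilpotent coincide. So `f` has degree `0`.

For the Toeplitz ring, `δ` comes from the universal property (`exists_graded_lift`). It descends to
the relative Cuntz–Pimsner ring because the added relations are homogeneous of degree `0`
(`exists_relCP_coaction`). -/

namespace AddMonoidAlgebra

/-! ### Idempotents of Laurent polynomial rings. -/

/-- An element of `K[ℤ]` over a commutative ring all of whose coefficients are nilpotent is
nilpotent. -/
theorem isNilpotent_of_forall_coeff {K : Type*} [CommRing K] {c : AddMonoidAlgebra K ℤ}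
    (h : ∀ n, IsNilpotent (c.coeff n)) : IsNilpotent c := by
  rw [← sum_coeff_single c, Finsupp.sum]
  refine isNilpotent_sum fun n _ ↦ ?_
  obtain ⟨k, hk⟩ := h n
  exact ⟨k, by rw [single_pow, hk, single_zero]⟩

/-- The idempotents of `K[ℤ]`, for a commutative ring `K`, are constant. -/
theorem coeff_eq_zero_of_isIdempotentElem {K : Type*} [CommRing K] {c : AddMonoidAlgebra K ℤ}
    (hc : IsIdempotentElem c) {n : ℤ} (hn : n ≠ 0) : c.coeff n = 0 := by
  -- Evaluation at `t = 1`; the constant that `c` must equal is `ε c`.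
  let ε : AddMonoidAlgebra K ℤ →ₐ[K] K := lift K K ℤ 1
  have hε : IsIdempotentElem (single (0 : ℤ) (ε c)) := by
    rw [IsIdempotentElem, single_mul_single, ← map_mul, hc.eq, add_zero]
  have hnil : IsNilpotent (c - single 0 (ε c)) := by
    -- A coefficient is nilpotent once it lies in every prime `p`, so the work moves to `(K ⧸
    -- p)[ℤ]`.
    refine isNilpotent_of_forall_coeff fun m ↦ nilpotent_iff_mem_prime.2 fun p hp ↦ ?_
    let φ := mapRingHom ℤ (Ideal.Quotient.mk p)
    let ε' : AddMonoidAlgebra (K ⧸ p) ℤ →ₐ[K ⧸ p] K ⧸ p := lift (K ⧸ p) (K ⧸ p) ℤ 1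
    have hcomm : Ideal.Quotient.mk p (ε c) = ε' (φ c) := by
      -- The identity is additive in `c` and holds for all `c`; idempotence would not survive the
      -- induction.
      clear hc hε
      induction c using AddMonoidAlgebra.induction_linear with
      | zero => simp
      | add a b ha hb => simp only [map_add, ha, hb]
      | single k r => simp [ε, ε', φ, -LaurentPolynomial.single_eq_C_mul_T]
    have hφ : φ (c - single 0 (ε c)) = 0 := by
      have h1 : φ (single 0 (ε c)) = single 0 (ε' (φ c)) := by
        simp [φ, ← hcomm, -LaurentPolynomial.single_eq_C_mul_T]
      rw [map_sub, h1]
      -- `(K ⧸ p)[ℤ]` has no zero divisors, so the reduced idempotent is `0` or `1`, and both are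
      -- constant.
      rcases IsIdempotentElem.iff_eq_zero_or_one.1 (hc.map φ) with h | h
      · simp [h]
      · rw [h, map_one, ← one_def, sub_self]
    have := congrArg (fun x ↦ x.coeff m) hφ
    rw [← Ideal.Quotient.eq_zero_iff_mem]
    simpa only [φ, coeff_mapRingHom, coeff_zero, Finsupp.zero_apply] using this
  have := eq_of_isNilpotent_sub_of_isIdempotentElem hc hε hnil
  rw [this, coeff_single, Finsupp.single_eq_of_ne hn]

/-- An idempotent of `U[ℤ]` with central coefficients is constant. -/
theorem coeff_eq_zero_of_isIdempotentElem_of_forall_mem_center {U : Type*} [Ring U]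
    {c : AddMonoidAlgebra U ℤ} (hc : IsIdempotentElem c)
    (hcent : ∀ n, c.coeff n ∈ Subring.center U) {n : ℤ} (hn : n ≠ 0) : c.coeff n = 0 := by
  let φ := mapRingHom ℤ (Subring.center U).subtype
  have hφ (x) (m : ℤ) : (φ x).coeff m = x.coeff m := by simp [φ]
  -- Central coefficients allow `c` to be lifted to Laurent polynomials over the centre, a
  -- commutative ring.
  obtain ⟨c, rfl⟩ : c ∈ φ.range := by
    rw [← sum_coeff_single c]
    exact sum_mem fun m _ ↦ ⟨single m ⟨_, hcent m⟩, by
      simp [φ, -LaurentPolynomial.single_eq_C_mul_T]⟩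
  have hinj : Function.Injective φ := fun x y h ↦ by
    ext m
    rw [← hφ, h, hφ]
  rw [hφ, coeff_eq_zero_of_isIdempotentElem (hinj ((map_mul φ c c).trans hc.eq)) hn]
  rfl

end AddMonoidAlgebra

namespace CuntzPimsner

open AddMonoidAlgebra

/-! ### Unitization, which supplies a unital coefficient ring. -/

/-- The unitization of a non-unital ring. -/
def Unitized (A : Type*) [NonUnitalRing A] : Type _ := Unitization ℤ A

noncomputable instance (A : Type*) [NonUnitalRing A] : Ring (Unitized A) :=
  inferInstanceAs (Ring (Unitization ℤ A))

section Unitized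

variable {A : Type*} [NonUnitalRing A]

/-- The inclusion of a non-unital ring in its unitization. -/
noncomputable def inr : A →ₙ+* Unitized A where
  toFun a := (a : Unitization ℤ A)
  map_zero' := Unitization.inr_zero ℤ
  map_add' := Unitization.inr_add ℤ
  map_mul' := Unitization.inr_mul ℤ

theorem inr_injective : Function.Injective (inr : A → Unitized A) :=
  Unitization.inr_injective (R := ℤ)

theorem exists_eq_intCast_add_inr (u : Unitized A) : ∃ (k : ℤ) (a : A), u = k + inr a := by
  refine ⟨u.fst, u.snd, ?_⟩
  have h : ((u.fst : ℤ) : Unitized A) = (Unitization.inl u.fst : Unitization ℤ A) :=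
    (map_intCast (Unitization.inlRingHom ℤ A) u.fst).symm
  rw [h]
  exact (Unitization.inl_fst_add_inr_snd_eq u).symm

theorem mem_center_of_forall_commute {u : Unitized A} (h : ∀ a : A, inr a * u = u * inr a) :
    u ∈ Subring.center (Unitized A) := by
  refine Subring.mem_center_iff.2 fun v ↦ ?_
  obtain ⟨k, a, rfl⟩ := exists_eq_intCast_add_inr v
  rw [add_mul, mul_add, h, Int.cast_comm]

end Unitized

/-! ### Gradings and central idempotents from a coaction. -/

section Coaction

variable {A : Type*} [NonUnitalRing A] {𝒜 : ℤ → AddSubgroup A}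
  {δ : A →ₙ+* AddMonoidAlgebra (Unitized A) ℤ}

/-- A family of additive subgroups that generates `A`, is closed under multiplication, and is
separated by a ring homomorphism `a ↦ a tⁿ` is a grading. -/
theorem isIntGrading_of_coaction (hδ : ∀ n, ∀ a ∈ 𝒜 n, δ a = single n (inr a))
    (htop : ⨆ n, 𝒜 n = ⊤) (hmul : ∀ (m n : ℤ) (a b : A), a ∈ 𝒜 m → b ∈ 𝒜 n → a * b ∈ 𝒜 (m + n)) :
    IsIntGrading 𝒜 := by
  refine ⟨⟨?_, ?_⟩, hmul⟩
  -- The coefficients of `δ` recover every component of a formal sum from its value in `A`, hence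
  -- injectivity.
  · have key (x : DirectSum ℤ fun n ↦ 𝒜 n) (n : ℤ) :
        (δ (DirectSum.coeAddMonoidHom 𝒜 x)).coeff n = inr (x n : A) := by
      induction x using DirectSum.induction_on with
      | zero => simp
      | of m a =>
        rw [DirectSum.coeAddMonoidHom_of, hδ m a a.2, coeff_single]
        rcases eq_or_ne m n with rfl | h
        · simp
        · simp [DirectSum.of_eq_of_ne _ _ _ h.symm, Finsupp.single_eq_of_ne h.symm]
      | add x y hx hy => simp [hx, hy]
    intro x y h
    refine DFinsupp.ext fun n ↦ Subtype.ext (inr_injective ?_)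
    rw [← key, h, key]
  · rw [← AddMonoidHom.range_eq_top, eq_top_iff, ← htop]
    exact iSup_le fun n a ha ↦ ⟨DirectSum.of (fun n ↦ 𝒜 n) n ⟨a, ha⟩, by simp⟩

theorem exists_coaction_coeff (hδ : ∀ n, ∀ a ∈ 𝒜 n, δ a = single n (inr a))
    (htop : ⨆ n, 𝒜 n = ⊤) (f : A) (n : ℤ) :
    ∃ a ∈ 𝒜 n, (δ f).coeff n = (inr a) := by
  have hf : f ∈ ⨆ n, 𝒜 n := htop ▸ AddSubgroup.mem_top f
  induction hf using AddSubgroup.iSup_induction' with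
  | hp m a ha =>
    rw [hδ m a ha, coeff_single]
    rcases eq_or_ne m n with rfl | h
    · exact ⟨a, ha, by simp⟩
    · exact ⟨0, zero_mem _, by simp [Finsupp.single_eq_of_ne h.symm]⟩
  | h1 => exact ⟨0, zero_mem _, by simp⟩
  | hadd x y _ _ hx hy =>
    obtain ⟨a, ha, hxa⟩ := hx
    obtain ⟨b, hb, hyb⟩ := hy
    exact ⟨a + b, add_mem ha hb, by simp [hxa, hyb]⟩

/-- Setting `t = 1` undoes `δ`, so an element is the sum of its homogeneous components. -/
theorem sum_coaction_coeff (hδ : ∀ n, ∀ a ∈ 𝒜 n, δ a = single n (inr a))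
    (htop : ⨆ n, 𝒜 n = ⊤) (f : A) :
    ((δ f).coeff.sum fun _ u ↦ u) = (inr f) := by
  have hf : f ∈ ⨆ n, 𝒜 n := htop ▸ AddSubgroup.mem_top f
  induction hf using AddSubgroup.iSup_induction' with
  | hp m a ha => rw [hδ m a ha, coeff_single, Finsupp.sum_single_index rfl]
  | h1 => simp
  | hadd x y _ _ hx hy =>
    rw [map_add, coeff_add, Finsupp.sum_add_index' (fun _ ↦ rfl) fun _ _ _ ↦ rfl, hx, hy,
      map_add]

/-- The coefficients of the image of a central element under a coaction are central. -/
theorem coaction_coeff_mem_center (hδ : ∀ n, ∀ a ∈ 𝒜 n, δ a = single n (inr a))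
    (htop : ⨆ n, 𝒜 n = ⊤) {f : A} (hf : f ∈ Set.center A) (n : ℤ) :
    (δ f).coeff n ∈ Subring.center (Unitized A) := by
  have hcomm (a : A) : (inr a) * (δ f).coeff n = (δ f).coeff n * inr a := by
    have ha : a ∈ ⨆ n, 𝒜 n := htop ▸ AddSubgroup.mem_top a
    induction ha using AddSubgroup.iSup_induction' with
    | hp m a ha =>
      have h : single m (inr a) * δ f = δ f * single m (inr a) := by
        rw [← hδ m a ha, ← map_mul, ← map_mul, (Semigroup.mem_center_iff.1 hf a)]
      -- Multiplication by `a tᵐ` shifts degrees by `m`, so the coefficient at `m + n` isolates the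
      -- `n`-th one of `δ f` on both sides.
      have h' := congrArg (fun x ↦ x.coeff (m + n)) h
      simpa only [coeff_single_mul_apply, coeff_mul_single_apply, neg_add_cancel_left,
        add_neg_cancel_comm] using h'
    | h1 => simp
    | hadd x y _ _ hx hy => rw [map_add, add_mul, mul_add, hx, hy]
  exact mem_center_of_forall_commute hcomm

/-- In a ring graded by a coaction `a ↦ a tⁿ`, every central idempotent has degree zero. -/
theorem mem_zero_of_isIdempotentElem_of_mem_center
    (hδ : ∀ n, ∀ a ∈ 𝒜 n, δ a = single n (inr a))
    (htop : ⨆ n, 𝒜 n = ⊤) {f : A} (hf : IsIdempotentElem f) (hfc : f ∈ Set.center A) :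
    f ∈ 𝒜 0 := by
  obtain ⟨a, ha, hfa⟩ := exists_coaction_coeff hδ htop f 0
  have h : δ f = single 0 (inr a) := by
    refine coeff_injective (Finsupp.ext fun n ↦ ?_)
    rcases eq_or_ne n 0 with rfl | hn
    · simp [hfa]
    · rw [coeff_eq_zero_of_isIdempotentElem_of_forall_mem_center (hf.map δ)
        (coaction_coeff_mem_center hδ htop hfc) hn, coeff_single, Finsupp.single_eq_of_ne hn]
  -- Only the degree-zero component `a` survives, so evaluation at `t = 1` gives `f = a`.
  have hsum := sum_coaction_coeff hδ htop f
  rw [h, coeff_single, Finsupp.sum_single_index rfl] at hsum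
  rwa [← inr_injective hsum]

end Coaction

/-! ### The coaction on the Toeplitz ring. -/

namespace RSystem

theorem word_mul {R P Q : Type*} (v w : FreeSemigroup (Gen R P Q)) : word (v * w) = word v * word w := by
  simp [word, MonoidAlgebra.single_mul_single]

theorem wordDeg_mul {R P Q : Type*} (v w : FreeSemigroup (Gen R P Q)) :
    wordDeg (v * w) = wordDeg v + wordDeg w := by
  simp [wordDeg, add_assoc]

variable {R P Q : Type*} [NonUnitalRing R] [AddCommGroup P] [AddCommGroup Q]
  [Bimodule R P] [Bimodule R Q] (X : RSystem R P Q)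

theorem toToeplitz_surjective : Function.Surjective X.toToeplitz := by
  rintro ⟨a⟩
  exact ⟨a, rfl⟩

theorem toToeplitz_word_mem (w : FreeSemigroup (Gen R P Q)) :
    X.toToeplitz (word w) ∈ X.toeplitzDeg (wordDeg w) :=
  AddSubgroup.subset_closure ⟨w, rfl, rfl⟩

theorem S_mem (p : P) : X.univ.S p ∈ X.toeplitzDeg (-1) :=
  X.toToeplitz_word_mem (FreeSemigroup.of (.left p))

theorem T_mem (q : Q) : X.univ.T q ∈ X.toeplitzDeg 1 :=
  X.toToeplitz_word_mem (FreeSemigroup.of (.right q))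

theorem σ_mem (r : R) : X.univ.σ r ∈ X.toeplitzDeg 0 :=
  X.toToeplitz_word_mem (FreeSemigroup.of (.coef r))

theorem toeplitzDeg_mul_mem (m n : ℤ) (a b : X.Toeplitz) (ha : a ∈ X.toeplitzDeg m)
    (hb : b ∈ X.toeplitzDeg n) : a * b ∈ X.toeplitzDeg (m + n) := by
  induction ha using AddSubgroup.closure_induction with
  | mem a ha =>
    obtain ⟨v, rfl, rfl⟩ := ha
    induction hb using AddSubgroup.closure_induction with
    | mem b hb =>
      obtain ⟨w, rfl, rfl⟩ := hb
      rw [← map_mul, ← word_mul, ← wordDeg_mul]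
      exact X.toToeplitz_word_mem _
    | zero => rw [mul_zero]; exact zero_mem _
    | add b c _ _ hb hc => rw [mul_add]; exact add_mem hb hc
    | neg b _ hb => rw [mul_neg]; exact neg_mem hb
  | zero => rw [zero_mul]; exact zero_mem _
  | add a c _ _ ha hc => rw [add_mul]; exact add_mem ha hc
  | neg a _ ha => rw [neg_mul]; exact neg_mem ha

theorem iSup_toeplitzDeg : ⨆ n, X.toeplitzDeg n = ⊤ := by
  refine eq_top_iff.2 fun t _ ↦ ?_
  obtain ⟨a, rfl⟩ := X.toToeplitz_surjective t
  induction a using MonoidAlgebra.induction_linear with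
  | zero => rw [map_zero]; exact zero_mem _
  | add a b ha hb => rw [map_add]; exact add_mem (ha trivial) (hb trivial)
  | single w n =>
    have : (MonoidAlgebra.single w n : FreeRing R P Q) = n • word w := by simp [word]
    rw [this, map_zsmul]
    exact zsmul_mem (AddSubgroup.mem_iSup_of_mem _ (X.toToeplitz_word_mem w)) n

/-- The covariant representation on `(ℤ ⊕ B)[ℤ]` that places the image of a covariant
representation on `B` in the degrees `-1`, `1` and `0`. -/
noncomputable def CovRep.graded {X : RSystem R P Q} {B : Type*} [NonUnitalRing B]
    (c : X.CovRep B) : X.CovRep (AddMonoidAlgebra (Unitized B) ℤ) where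
  S := AddMonoidHom.mk' (fun p ↦ single (-1) (inr (c.S p))) fun p p' ↦ by
    rw [map_add, map_add, single_add]
  T := AddMonoidHom.mk' (fun q ↦ single 1 (inr (c.T q))) fun q q' ↦ by
    rw [map_add, map_add, single_add]
  σ :=
    { AddMonoidHom.mk' (fun r ↦ single 0 (inr (c.σ r))) fun r s ↦ by
        rw [map_add, map_add, single_add] with
      map_mul' := fun r s ↦ by
        simp [single_mul_single, -LaurentPolynomial.single_eq_C_mul_T] }
  S_ract p r := by
    change single (-1) (inr (c.S _)) = single (-1) _ * single 0 _
    rw [single_mul_single, c.S_ract, map_mul]; rfl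
  S_lact r p := by
    change single (-1) (inr (c.S _)) = single 0 _ * single (-1) _
    rw [single_mul_single, c.S_lact, map_mul]; rfl
  T_ract q r := by
    change single 1 (inr (c.T _)) = single 1 _ * single 0 _
    rw [single_mul_single, c.T_ract, map_mul]; rfl
  T_lact r q := by
    change single 1 (inr (c.T _)) = single 0 _ * single 1 _
    rw [single_mul_single, c.T_lact, map_mul]; rfl
  σ_pair p q := by
    change single 0 (inr (c.σ _)) = single (-1) _ * single 1 _
    rw [single_mul_single, c.σ_pair, map_mul]; rfl

/-- A covariant representation transported along a ring homomorphism. -/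
def CovRep.comp {X : RSystem R P Q} {A B : Type*} [NonUnitalRing A] [NonUnitalRing B]
    (c : X.CovRep A) (φ : A →ₙ+* B) : X.CovRep B where
  S := (φ : A →+ B).comp c.S
  T := (φ : A →+ B).comp c.T
  σ := φ.comp c.σ
  S_ract p r := by simp [c.S_ract]
  S_lact r p := by simp [c.S_lact]
  T_ract q r := by simp [c.T_ract]
  T_lact r q := by simp [c.T_lact]
  σ_pair p q := by simp [c.σ_pair]

/-- A ring homomorphism `φ` on the Toeplitz ring lifts to the ring homomorphism
`t ↦ φ(t) xⁿ` for `t` of degree `n`. -/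
theorem exists_graded_lift {B : Type*} [NonUnitalRing B] (φ : X.Toeplitz →ₙ+* B) :
    ∃ δ : X.Toeplitz →ₙ+* AddMonoidAlgebra (Unitized B) ℤ,
      ∀ n, ∀ t ∈ X.toeplitzDeg n, δ t = single n (inr (φ t)) := by
  obtain ⟨δ, ⟨hS, hT, hσ⟩, -⟩ := X.toeplitz_universal (X.univ.comp φ).graded
  refine ⟨δ, fun n t ht ↦ ?_⟩
  induction ht using AddSubgroup.closure_induction with
  | mem t ht =>
    obtain ⟨w, rfl, rfl⟩ := ht
    induction w using FreeSemigroup.recOnMul with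
    | ih1 x =>
      cases x with
      | coef r => exact hσ r
      | left p => exact hS p
      | right q => exact hT q
    | ih2 x w hx hw =>
      rw [word_mul, map_mul, map_mul, hx, hw, single_mul_single, map_mul, wordDeg_mul,
        map_mul]
  | zero => simp
  | add t u _ _ ht hu => simp [ht, hu]
  | neg t _ ht => rw [map_neg, map_neg, ht, map_neg, single_neg]

/-- The generators `ι_Q(q) ι_P(p)` have degree `1 + (-1) = 0`; this makes the Cuntz–Pimsner
relations homogeneous. -/
theorem snd_mem_of_mem_piGraph {a : AddMonoid.End Q × X.Toeplitz} (ha : a ∈ X.piGraph) :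
    a.2 ∈ X.toeplitzDeg 0 := by
  have hle : X.piGraph ≤
      (X.toeplitzDeg 0).comap (AddMonoidHom.snd (AddMonoid.End Q) X.Toeplitz) := by
    refine (AddSubgroup.closure_le _).2 ?_
    rintro _ ⟨q, p, rfl⟩
    exact X.toeplitzDeg_mul_mem 1 (-1) _ _ (X.T_mem q) (X.S_mem p)
  exact hle ha

/-! ### The coaction on the relative Cuntz–Pimsner ring. -/

variable (J : TwoSidedIdeal R)

theorem toRelCP_surjective : Function.Surjective (X.toRelCP J) := by
  rintro ⟨a⟩
  exact ⟨a, rfl⟩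

theorem toRelCP_eq_zero {a : X.Toeplitz} (ha : a ∈ X.cpIdeal J) : X.toRelCP J a = 0 :=
  (RingCon.eq _).2 ha

theorem iSup_relCPDeg : ⨆ n, X.relCPDeg J n = ⊤ := by
  simp only [relCPDeg]
  rw [← AddSubgroup.map_iSup, iSup_toeplitzDeg]
  exact AddSubgroup.map_top_of_surjective _ (X.toRelCP_surjective J)

theorem relCPDeg_mul_mem (m n : ℤ) (a b : X.RelCP J) (ha : a ∈ X.relCPDeg J m)
    (hb : b ∈ X.relCPDeg J n) : a * b ∈ X.relCPDeg J (m + n) := by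
  obtain ⟨a, ha, rfl⟩ := ha
  obtain ⟨b, hb, rfl⟩ := hb
  exact ⟨a * b, X.toeplitzDeg_mul_mem m n a b ha hb, map_mul (X.toRelCP J) a b⟩

/-- The graded lift of the quotient map sends a degree-zero generator of `cpIdeal` to its class
placed in degree `0`, which is zero. It therefore kills the whole ideal and factors through the
quotient. -/
theorem exists_relCP_coaction :
    ∃ δ : X.RelCP J →ₙ+* AddMonoidAlgebra (Unitized (X.RelCP J)) ℤ,
      ∀ n, ∀ a ∈ X.relCPDeg J n, δ a = single n (inr a) := by
  obtain ⟨δ, hδ⟩ := X.exists_graded_lift (X.toRelCP J)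
  have hker : X.cpIdeal J ≤ TwoSidedIdeal.ker δ := by
    refine TwoSidedIdeal.span_le.2 ?_
    rintro _ ⟨x, hx, t, ht, rfl⟩
    have h0 : X.toRelCP J (X.univ.σ x - t) = 0 :=
      X.toRelCP_eq_zero J (TwoSidedIdeal.subset_span ⟨x, hx, t, ht, rfl⟩)
    rw [SetLike.mem_coe, TwoSidedIdeal.mem_ker,
      hδ 0 _ (sub_mem (X.σ_mem x) (X.snd_mem_of_mem_piGraph ht)), h0]
    simp
  have hle : ∀ a b, (X.cpIdeal J).ringCon a b → δ a = δ b := fun a b h ↦ by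
    rw [← sub_eq_zero, ← map_sub, ← TwoSidedIdeal.mem_ker]
    exact hker ((TwoSidedIdeal.rel_iff _ _ _).1 h)
  let δ' : X.RelCP J →ₙ+* AddMonoidAlgebra (Unitized (X.RelCP J)) ℤ :=
    { toFun := fun t ↦ Quotient.liftOn' t δ hle
      map_zero' := map_zero δ
      map_add' := by
        rintro ⟨a⟩ ⟨b⟩
        exact map_add δ a b
      map_mul' := by
        rintro ⟨a⟩ ⟨b⟩
        exact map_mul δ a b }
  refine ⟨δ', ?_⟩
  rintro n _ ⟨t, ht, rfl⟩
  exact hδ n t ht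

end RSystem

end CuntzPimsner

theorem mainTheorem12 {R P Q : Type*} [NonUnitalRing R] [AddCommGroup P] [AddCommGroup Q]
    [CuntzPimsner.Bimodule R P] [CuntzPimsner.Bimodule R Q]
    (X : CuntzPimsner.RSystem R P Q) :
    (CuntzPimsner.IsIntGrading X.toeplitzDeg ∧
      ∀ f : X.Toeplitz, IsIdempotentElem f → f ∈ Set.center X.Toeplitz → f ∈ X.toeplitzDeg 0) ∧
    (X.ConditionFS → ∀ J : TwoSidedIdeal R, X.IsCompatible J →
      CuntzPimsner.IsIntGrading (X.relCPDeg J) ∧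
      ∀ f : X.RelCP J, IsIdempotentElem f → f ∈ Set.center (X.RelCP J) →
        f ∈ X.relCPDeg J 0) := by
  constructor
  -- Lifting the identity gives the coaction of the Toeplitz ring on itself.
  · obtain ⟨δ, hδ⟩ := X.exists_graded_lift (NonUnitalRingHom.id X.Toeplitz)
    have htop := X.iSup_toeplitzDeg
    exact ⟨CuntzPimsner.isIntGrading_of_coaction hδ htop X.toeplitzDeg_mul_mem, fun f hf hfc ↦
      CuntzPimsner.mem_zero_of_isIdempotentElem_of_mem_center hδ htop hf hfc⟩
  · intro _ J _
    obtain ⟨δ, hδ⟩ := X.exists_relCP_coaction J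
    have htop := X.iSup_relCPDeg J
    exact ⟨CuntzPimsner.isIntGrading_of_coaction hδ htop (X.relCPDeg_mul_mem J), fun f hf hfc ↦
      CuntzPimsner.mem_zero_of_isIdempotentElem_of_mem_center hδ htop hf hfc⟩
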